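/- **Definitions.** Let $\mathbb S_\infty$ be the category of all cardinal numbers and surjections (a cardinal $\alpha$ stands for a set $(\alpha]$ of cardinality $\alpha$). A functor $T:\mathbf{Set}\to\mathbf{Set}$ is *semi-analytic* if there are a functor $R:\mathbb S_\infty\to\mathbf{Set}$ and bijections, natural in $X$, $$T(X)\;\cong\;\sum_{\alpha}\left[{X\atop\alpha}\right]\otimes_\alpha R_\alpha ,$$ where $\left[{X\atop\alpha}\right]$ is the set of injections $\vec x:(\alpha]\to X$ and $\otimes_\alpha$ means that $(\vec x\circ\sigma,r)$ is identified with $(\vec x,R(\sigma)(r))$ for all permutations $\sigma$ of $(\alpha]$; a function $f:X\to Y$ acts on the right by $[\vec x,r]\mapsto[\vec z,R(g)(r)]$, where $\vec z\circ g=f\circ\vec x$ is the factorization into a surjection $g$ and an injection $\vec z$. A natural transformation is *semi-cartesian* if its naturality squares at injections are pullbacks. A *semi-analytic monad* (an object of $\mathbf{SANMND}$) is a monad on $\mathbf{Set}$ whose functor is semi-analytic and whose unit and multiplication are semi-cartesian. Let $A$ be a suplattice (an algebra for the powerset monad, the terminal object of $\mathbf{SANMND}$). A *regular polynomial* $a\to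 b$ over $A$ is a subset $S\subseteq A$ with $a\in S$ and $\bigvee S=b$; write $(S,a)$ for it. The identity of $a$ is $(\{a\},a)$, and the composite (by substitution) of $(S,a):a\to b$ and $(S',b):b\to c$ is $((S'\setminus\{b\})\cup S,\,a)$. A *functor* $\mathbf F$ from the regular polynomials over $A$, $CP_{\infty r}(A)$, to a category assigns an object to each $a\in A$ and a morphism $\mathbf F(a)\to \mathbf F(b)$ to each regular polynomial $a\to b$, preserving these identities and composites. (Substitution is not associative in general; associativity is not used.) Let $T$ be a semi-analytic monad, let $\mathbf F:CP_{\infty r}(A)\to\mathcal{EM}(T)$ be a functor, write $\mathbf F(a)=(F(a),\xi_a)$, and let $p:\coprod_{a\in A}F(a)\to A$ be the projection. For $[\vec x,r]\in T(\coprod_aF(a))$, with $\vec x:(\alpha]\to\coprod_aF(a)$ injective, let $S$ be the image of $p\circ\vec x$, let $b=\bigvee S$, and let $f:(\alpha]\to F(b)$ send $i$ to the image of the element $\vec x(i)\in F(p\vec x(i))$ under $F$ applied to $(S,p\vec x(i)):p\vec x(i)\to b$. Put $$\lambda^T_F([\vec x,r])=[\vec z,R(g)(r)]\in T(F(b)),\qquad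 \vec z\circ g=f \text{ with } g \text{ surjective and } \vec z \text{ injective}.$$ The *Płonka structure map* of $\mathbf F$ is $\big(\coprod_a\xi_a\big)\circ\lambda^T_F:T(\coprod_aF(a))\to\coprod_aF(a)$. A $T$-algebra $B$, with a bijection $e$ from its underlying set to $\coprod_aF(a)$, is a *Płonka sum* of $\mathbf F$ if $e$ carries the structure map of $B$ to the Płonka structure map of $\mathbf F$. (Thus $\mathbf F$ has a Płonka sum iff its Płonka structure map is a $T$-algebra structure.) A morphism of monads $\tau:\mathcal R\to\mathcal V$ (a natural transformation compatible with units and multiplications) induces $\mathcal{EM}(\tau):\mathcal{EM}(\mathcal V)\to\mathcal{EM}(\mathcal R)$, $(B,\beta)\mapsto(B,\beta\circ\tau_B)$. It *preserves Płonka sums* if, for every suplattice $A$ and every functor $\mathbf F:CP_{\infty r}(A)\to\mathcal{EM}(\mathcal V)$, whenever $(B,e)$ is a Płonka sum of $\mathbf F$, $(\mathcal{EM}(\tau)(B),e)$ is a Płonka sum of $\mathcal{EM}(\tau)\circ\mathbf F$. **Theorem.** Let $\tau:\mathcal R\to\mathcal V$ be an arbitrary morphism of monads between semi-analytic monads $\mathcal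 R,\mathcal V$ in $\mathbf{SANMND}$. Then the following are equivalent. 1. $\tau$ is semi-cartesian. 2. The functor $\mathcal{EM}(\tau):\mathcal{EM}(\mathcal V)\to\mathcal{EM}(\mathcal R)$ preserves Płonka sums. 3. For every suplattice $A$ and every functor $\mathbf F:CP_{\infty r}(A)\to\mathcal{EM}(\mathcal V)$, with $\mathbf F(a)=(F(a),\xi_a)$, the two $\mathcal R$-structure maps on $\coprod_aF(a)$ coincide: $$\Big(\coprod_a\xi_a\circ\tau_{F(a)}\Big)\circ\lambda^{\mathcal R}_F=\Big(\coprod_a\xi_a\Big)\circ\lambda^{\mathcal V}_F\circ\tau_{\coprod_aF(a)} .$$ -/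

import Mathlib

open CategoryTheory

universe u v w v' w'

namespace Plonka

/-! ### Semi-analytic functors and monads on sets -/

/-- Objects of the category of all cardinal numbers and surjections. -/
structure CardSurj : Type (u + 1) where
  card : Cardinal.{u}

/-- The standard set of cardinality `α`. -/
abbrev CardSurj.toSet (α : CardSurj.{u}) : Type u := α.card.out

instance : Category.{u} CardSurj.{u} where
  Hom α β := {f : α.toSet → β.toSet // Function.Surjective f}
  id _ := ⟨id, Function.surjective_id⟩
  comp f g := ⟨g.1 ∘ f.1, g.2.comp f.2⟩

/-- A permutation of the standard set of cardinality `α`, as a surjection. -/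
def permHom {α : CardSurj.{u}} (σ : Equiv.Perm α.toSet) : α ⟶ α :=
  ⟨σ, σ.surjective⟩

/-- The identification `(x ∘ σ, r) ∼ (x, R(σ)(r))`, for permutations `σ`, of pairs consisting of
an injection `x : α → X` and an element `r` of `R(α)`. -/
def termSetoid (R : CardSurj.{u} ⥤ Type u) (X : Type u) (α : CardSurj.{u}) :
    Setoid ((α.toSet ↪ X) × R.obj α) where
  r p q := ∃ σ : Equiv.Perm α.toSet,
    p.1 = σ.toEmbedding.trans q.1 ∧ q.2 = R.map (permHom σ) p.2
  iseqv :=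
    { refl := fun p => ⟨Equiv.refl _, by ext; rfl, by
        have : permHom (Equiv.refl α.toSet) = 𝟙 α := rfl
        rw [this, R.map_id]; rfl⟩
      symm := by
        rintro ⟨x, r⟩ ⟨y, s⟩ ⟨σ, h1, h2⟩
        refine ⟨σ.symm, ?_, ?_⟩
        · simp only at h1
          subst h1
          ext i
          simp
        · simp only at h2 ⊢
          subst h2
          have h : permHom σ ≫ permHom σ.symm = 𝟙 α := by
            apply Subtype.ext
            funext i
            exact σ.symm_apply_apply i
          have h' := congrArg (fun f => (R.map f) r) h
          simpa using h'.symm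
      trans := by
        rintro ⟨x, r⟩ ⟨y, s⟩ ⟨z, t⟩ ⟨σ, h1, h2⟩ ⟨ρ, h3, h4⟩
        refine ⟨σ.trans ρ, ?_, ?_⟩
        · simp only at h1 h3
          subst h1 h3
          rfl
        · simp only at h2 h4 ⊢
          subst h2 h4
          have h : permHom σ ≫ permHom ρ = permHom (σ.trans ρ) := rfl
          rw [← h]
          simp }

/-- The class `∑_α [X choose α] ⊗_α R(α)`, where `[X choose α]` is the set of injections
`α → X`, and `α` ranges over all cardinal numbers. -/
abbrev Terms (R : CardSurj.{u} ⥤ Type u) (X : Type u) : Type (u + 1) :=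
  Σ α : CardSurj.{u}, Quotient (termSetoid R X α)

/-- The element `[x, r]`. -/
def Terms.mk {R : CardSurj.{u} ⥤ Type u} {X : Type u} {α : CardSurj.{u}}
    (x : α.toSet ↪ X) (r : R.obj α) : Terms R X :=
  ⟨α, Quotient.mk (termSetoid R X α) (x, r)⟩

/-- A presentation `T(X) ≅ ∑_α [X choose α] ⊗_α R(α)`, natural in `X`, of a functor `T`. On the
right-hand side, a function `f : X → Y` sends `[x, r]` to `[z, R(g)(r)]`, where `z ∘ g = f ∘ x`
is a factorization of `f ∘ x` into a surjection `g` followed by an injection `z`. -/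
structure SemiAnalytic (T : Type u ⥤ Type u) where
  coeff : CardSurj.{u} ⥤ Type u
  equiv : ∀ X : Type u, Terms coeff X ≃ T.obj X
  natural : ∀ {X Y : Type u} (f : X ⟶ Y) {α β : CardSurj.{u}} (x : α.toSet ↪ X)
    (r : coeff.obj α) (g : α ⟶ β) (z : β.toSet ↪ Y), (∀ i, z (g.1 i) = f (x i)) →
    T.map f (equiv X (Terms.mk x r)) = equiv Y (Terms.mk z (coeff.map g r))

/-- A natural transformation is semi-cartesian if its naturality squares at injections are
pullbacks. -/
def IsSemiCartesian {F G : Type u ⥤ Type u} (τ : F ⟶ G) : Prop :=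
  ∀ ⦃X Y : Type u⦄ (f : X ⟶ Y), Function.Injective f →
    IsPullback (F.map f) (τ.app X) (τ.app Y) (G.map f)

/-- A semi-analytic monad (of arbitrary, not necessarily bounded, arity): a monoid in the monoidal
category of semi-analytic functors and semi-cartesian natural transformations. -/
structure SANMonad : Type (u + 1) where
  monad : CategoryTheory.Monad (Type u)
  semiAnalytic : SemiAnalytic monad.toFunctor
  unit_semiCartesian : IsSemiCartesian monad.η
  mult_semiCartesian : IsSemiCartesian monad.μ

/-! ### Regular polynomials over a suplattice -/

section Polynomials

variable {A : Type u} [CompleteSemilatticeSup A]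

/-- A morphism `a → b` of the regular polynomials over a suplattice `A`. The powerset monad has
exactly one operation (supremum) in each arity, so that the class `[x, i, r]` of an injection
`x : α → A`, an index `i : α` and the unique `α`-ary operation `r` is given by the image `S` of
`x` and its element `x i`; its source is `x i` and its target is the value `sSup S`. -/
@[ext]
structure RegPoly (a b : A) where
  carrier : Set A
  source_mem : a ∈ carrier
  sSup_eq : sSup carrier = b

/-- The variable `a` as a polynomial `a → a`. -/
def RegPoly.id (a : A) : RegPoly a a where
  carrier := {a}
  source_mem := rfl
  sSup_eq := (isLUB_sSup _).unique isLUB_singleton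

/-- Substitution: `P` is put in place of the marked variable `b` of `Q`. -/
def RegPoly.comp {a b c : A} (P : RegPoly a b) (Q : RegPoly b c) : RegPoly a c where
  carrier := (Q.carrier \ {b}) ∪ P.carrier
  source_mem := Or.inr P.source_mem
  sSup_eq := by
    have hP := P.sSup_eq ▸ isLUB_sSup P.carrier
    have hQ := Q.sSup_eq ▸ isLUB_sSup Q.carrier
    refine (isLUB_sSup _).unique ⟨?_, ?_⟩
    · rintro x (hx | hx)
      · exact hQ.1 hx.1
      · exact (hP.1 hx).trans (hQ.1 Q.source_mem)
    · intro y hy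
      refine hQ.2 fun x hx => ?_
      by_cases h : x = b
      · exact h ▸ hP.2 fun z hz => hy (Or.inr hz)
      · exact hy (Or.inl ⟨hx, h⟩)

variable (A) in
/-- A functor from the regular polynomials over `A` to `C`: it preserves the identities and the
substitution of regular polynomials. -/
structure PolyFunctor (C : Type w) [Category.{v} C] where
  obj : A → C
  map : ∀ {a b : A}, RegPoly a b → (obj a ⟶ obj b)
  map_id : ∀ a : A, map (RegPoly.id a) = 𝟙 (obj a)
  map_comp : ∀ {a b c : A} (P : RegPoly a b) (Q : RegPoly b c),
    map (P.comp Q) = map P ≫ map Q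

/-- Postcomposition of a functor on regular polynomials with a functor. -/
@[simps]
def PolyFunctor.postcomp {C : Type w} [Category.{v} C] {D : Type w'} [Category.{v'} D]
    (F : PolyFunctor A C) (G : C ⥤ D) : PolyFunctor A D where
  obj a := G.obj (F.obj a)
  map P := G.map (F.map P)
  map_id a := by rw [F.map_id, G.map_id]
  map_comp P Q := by rw [F.map_comp, G.map_comp]

/-! ### Płonka sums -/

/-- The coproduct `∐_{a ∈ A} F(a)`. -/
abbrev coprod (F : PolyFunctor A (Type u)) : Type u := Σ a : A, F.obj a

/-- The functions `F(ψ_i)` joined together: given `x i = (a_i, y_i)` for `i : α`, and `S` containing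
all the `a_i`, move each `y_i ∈ F(a_i)` to `F(sSup S)` along the polynomial `(S, a_i)`. -/
def transport (F : PolyFunctor A (Type u)) {I : Type u} (x : I → coprod F) (S : Set A)
    (h : ∀ i, (x i).1 ∈ S) : I ⟶ F.obj (sSup S) :=
  ↾(fun i => F.map ⟨S, h i, rfl⟩ (x i).2)

variable {T : Type u ⥤ Type u}

/-- The component at `F` of `λ : T ∘ ∐ ⟶ ∐ ∘ T̂`, on representatives. Let `S = {a_i}` be the image of
`x` in `A`, let `b = sSup S`, and let `f : α → F(b)` move the arguments to `F(b)`. Then `[x, r]` is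
sent to `T(f)([id, r]) = [z, R(g)(r)] ∈ T(F(b))`, where `z ∘ g = f` is the surjection-injection
factorization of `f`. -/
def lambdaMk (E : SemiAnalytic T) (F : PolyFunctor A (Type u)) {α : CardSurj.{u}}
    (x : α.toSet ↪ coprod F) (r : E.coeff.obj α) : Σ a : A, T.obj (F.obj a) :=
  ⟨sSup (Set.range fun i => (x i).1),
    T.map (transport F x (Set.range fun i => (x i).1) Set.mem_range_self)
      (E.equiv α.toSet (Terms.mk (Function.Embedding.refl _) r))⟩

theorem lambdaMk_congr (E : SemiAnalytic T) (F : PolyFunctor A (Type u)) {α : CardSurj.{u}}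
    (y : α.toSet ↪ coprod F) (r : E.coeff.obj α) (σ : Equiv.Perm α.toSet) :
    lambdaMk E F (σ.toEmbedding.trans y) r = lambdaMk E F y (E.coeff.map (permHom σ) r) := by
  have key : ∀ (S S' : Set A) (hS : ∀ i, (y i).1 ∈ S) (hS' : ∀ i, (y (σ i)).1 ∈ S'), S' = S →
      (⟨sSup S', T.map (transport F (fun i => y (σ i)) S' hS')
        (E.equiv α.toSet (Terms.mk (Function.Embedding.refl _) r))⟩ :
          Σ a : A, T.obj (F.obj a)) =
      ⟨sSup S, T.map (transport F y S hS) (E.equiv α.toSet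
        (Terms.mk (Function.Embedding.refl _) (E.coeff.map (permHom σ) r)))⟩ := by
    rintro S S' hS hS' rfl
    have h1 : transport F (fun i => y (σ i)) S' hS' =
        (↾(fun i => σ i) : α.toSet ⟶ α.toSet) ≫ transport F y S' hS := rfl
    rw [← E.natural (↾(fun i => σ i) : α.toSet ⟶ α.toSet) (Function.Embedding.refl _) r
      (permHom σ) (Function.Embedding.refl _) (fun _ => rfl), h1, T.map_comp]
    rfl
  refine key _ _ Set.mem_range_self Set.mem_range_self ?_
  exact σ.surjective.range_comp (fun i => (y i).1)

/-- The element `[z, R(g)(r)]` for any factorization `z ∘ g = f`. -/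
theorem lambdaMk_eq (E : SemiAnalytic T) (F : PolyFunctor A (Type u)) {α β : CardSurj.{u}}
    (x : α.toSet ↪ coprod F) (r : E.coeff.obj α) (g : α ⟶ β)
    (z : β.toSet ↪ F.obj (sSup (Set.range fun i => (x i).1)))
    (h : ∀ i, z (g.1 i) = F.map ⟨Set.range fun i => (x i).1, Set.mem_range_self i, rfl⟩ (x i).2) :
    lambdaMk E F x r = ⟨_, E.equiv _ (Terms.mk z (E.coeff.map g r))⟩ := by
  unfold lambdaMk
  rw [E.natural (transport F x _ Set.mem_range_self) (Function.Embedding.refl _) r g z h]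

/-- The function `[x, r] ↦ λ_F([x, r])`. -/
def lambdaTerm (E : SemiAnalytic T) (F : PolyFunctor A (Type u))
    (t : Terms E.coeff (coprod F)) : Σ a : A, T.obj (F.obj a) :=
  Quotient.lift (s := termSetoid E.coeff (coprod F) t.1)
    (fun p => lambdaMk E F p.1 p.2) (by
      rintro ⟨x, r⟩ ⟨y, s⟩ ⟨σ, h1, h2⟩
      simp only at h1 h2
      subst h1 h2
      exact lambdaMk_congr E F y r σ) t.2

/-- The component at `F` of `λ : T ∘ ∐ ⟶ ∐ ∘ T̂`. -/
def lambda (E : SemiAnalytic T) (F : PolyFunctor A (Type u))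
    (t : T.obj (coprod F)) : Σ a : A, T.obj (F.obj a) :=
  lambdaTerm E F ((E.equiv (coprod F)).symm t)

theorem lambda_mk (E : SemiAnalytic T) (F : PolyFunctor A (Type u)) {α : CardSurj.{u}}
    (x : α.toSet ↪ coprod F) (r : E.coeff.obj α) :
    lambda E F (E.equiv _ (Terms.mk x r)) = lambdaMk E F x r := by
  unfold lambda
  rw [Equiv.symm_apply_apply]
  rfl

/-- The family of underlying sets of a family of algebras. -/
abbrev underlying {T : CategoryTheory.Monad (Type u)} (F : PolyFunctor A T.Algebra) :
    PolyFunctor A (Type u) :=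
  F.postcomp T.forget

/-- The structure map `(∐_a ξ_a) ∘ λ_F : T(∐_a F(a)) → ∐_a F(a)` of the Płonka sum of the algebras
`(F(a), ξ_a)`. -/
def plonkaMap (T : SANMonad.{u}) (F : PolyFunctor A T.monad.Algebra)
    (t : T.monad.obj (coprod (underlying F))) : coprod (underlying F) :=
  let p := lambda T.semiAnalytic (underlying F) t
  ⟨p.1, (F.obj p.1).a p.2⟩

/-- The algebra `B` is the Płonka sum of `F`, through the bijection `e` of its underlying set with
the coproduct of the underlying sets. -/
def IsPlonkaSum (T : SANMonad.{u}) (F : PolyFunctor A T.monad.Algebra) (B : T.monad.Algebra)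
    (e : B.A ≅ coprod (underlying F)) : Prop :=
  ∀ t : T.monad.obj B.A, e.hom (B.a t) = plonkaMap T F (T.monad.map e.hom t)

end Polynomials

/-- The functor `EM(τ) : EM(V) → EM(R)` induced by a morphism of monads `τ : R → V`. -/
abbrev EM {R V : CategoryTheory.Monad (Type u)} (τ : R ⟶ V) : V.Algebra ⥤ R.Algebra :=
  CategoryTheory.Monad.algebraFunctorOfMonadHom τ

/-- `EM(τ)` preserves Płonka sums: if `B` is the Płonka sum of `F`, then `EM(τ)(B)` is, through the
same bijection, the Płonka sum of `EM(τ) ∘ F`. -/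
def PreservesPlonkaSums {R V : SANMonad.{u}} (τ : R.monad ⟶ V.monad) : Prop :=
  ∀ (A : Type u) [CompleteSemilatticeSup A] (F : PolyFunctor A V.monad.Algebra)
    (B : V.monad.Algebra) (e : B.A ≅ coprod (underlying F)),
    IsPlonkaSum V F B e → IsPlonkaSum R (F.postcomp (EM τ)) ((EM τ).obj B) e

/-- The two `R`-structures on `∐_a F(a)`, induced by `λ` for `R` and by `λ` for `V`, coincide for
all functors `F` from the regular polynomials over a suplattice to the category of
`V`-algebras. -/
def PlonkaStructuresCoincide {R V : SANMonad.{u}} (τ : R.monad ⟶ V.monad) : Prop :=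
  ∀ (A : Type u) [CompleteSemilatticeSup A] (F : PolyFunctor A V.monad.Algebra)
    (t : R.monad.obj (coprod (underlying F))),
    plonkaMap R (F.postcomp (EM τ)) t = plonkaMap V F (τ.app _ t)

end Plonka

/-! Every `t` in `T(X)` has a support, the image of `x` in any presentation `t = [x, r]`. For
injective `f` with codomain `X`, `t` comes from the domain of `f` exactly when its support lies in
the range of `f`. Hence a natural transformation can only shrink supports, and it is semi-cartesian
iff it preserves them (`isSemiCartesian_iff_supp`).

1 → 3: write `[x, r]` as the image under `x` of a term of full support. If `τ` preserves supports,
both structure maps take the supremum over the same indices and transport along the same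
polynomials, so they agree by naturality of `τ`. 3 → 2 is naturality of `τ` at `e`.

2 → 1: since unit and multiplication are semi-cartesian, the supremum of the support makes any
suplattice a `V`-algebra, and this is the Płonka sum of one-point algebras. Its preservation says
that `τ` keeps the supremum of the support. In a powerset, on terms in singletons, this supremum is
the support itself. -/

namespace Plonka

/-! ### The support of a term -/

section Support

variable {T : Type u ⥤ Type u}

/-- The support of `[x, r]` is the image of `x`. -/
def Terms.supp {C : CardSurj.{u} ⥤ Type u} {X : Type u} (t : Terms C X) : Set X :=
  Quotient.lift (s := termSetoid C X t.1)
    (fun p => Set.range p.1) (by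
      rintro ⟨x, r⟩ ⟨y, s⟩ ⟨σ, h1, h2⟩
      simp only at h1 h2
      subst h1 h2
      exact σ.surjective.range_comp y) t.2

/-- The support of an element of `T(X)`. -/
def SemiAnalytic.supp (E : SemiAnalytic T) {X : Type u} (t : T.obj X) : Set X :=
  ((E.equiv X).symm t).supp

namespace SemiAnalytic

variable (E : SemiAnalytic T)

theorem supp_mk {X : Type u} {α : CardSurj.{u}} (x : α.toSet ↪ X) (r : E.coeff.obj α) :
    E.supp (E.equiv X (Terms.mk x r)) = Set.range x := by
  unfold supp
  rw [Equiv.symm_apply_apply]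
  rfl

theorem exists_eq_mk {X : Type u} (t : T.obj X) :
    ∃ (α : CardSurj.{u}) (x : α.toSet ↪ X) (r : E.coeff.obj α),
      t = E.equiv X (Terms.mk x r) := by
  obtain ⟨⟨α, q⟩, rfl⟩ := (E.equiv X).surjective t
  induction q using Quotient.inductionOn with
  | h p => exact ⟨α, p.1, p.2, rfl⟩

theorem exists_factorization {X : Type u} {α : CardSurj.{u}} (f : α.toSet → X) :
    ∃ (β : CardSurj.{u}) (g : α ⟶ β) (z : β.toSet ↪ X), ∀ i, z (g.1 i) = f i := by
  obtain ⟨e⟩ : Nonempty (Set.range f ≃ (Cardinal.mk (Set.range f)).out) :=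
    Cardinal.eq.1 (Cardinal.mk_out _).symm
  refine ⟨⟨Cardinal.mk (Set.range f)⟩, ⟨fun i => e ⟨f i, i, rfl⟩, ?_⟩,
    e.symm.toEmbedding.trans (Function.Embedding.subtype _), fun i => ?_⟩
  · intro b
    obtain ⟨⟨_, i, rfl⟩, rfl⟩ := e.surjective b
    exact ⟨i, rfl⟩
  · simp

/-- The action replaces `x` by `z` with `z ∘ g = f ∘ x`, and surjectivity of `g` leaves `z` the same
image as `f ∘ x`. -/
theorem supp_map {X Y : Type u} (f : X ⟶ Y) (t : T.obj X) :
    E.supp (T.map f t) = f '' E.supp t := by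
  obtain ⟨α, x, r, rfl⟩ := E.exists_eq_mk t
  obtain ⟨β, g, z, h⟩ := exists_factorization fun i => f (x i)
  rw [E.natural f x r g z h, supp_mk, supp_mk, ← g.2.range_comp z, ← Set.range_comp]
  exact congrArg Set.range (funext h)

theorem map_mk_of_injective {X Y : Type u} (f : X ⟶ Y) (hf : Function.Injective f)
    {α : CardSurj.{u}} (x : α.toSet ↪ X) (r : E.coeff.obj α) :
    T.map f (E.equiv X (Terms.mk x r)) = E.equiv Y (Terms.mk (x.trans ⟨f, hf⟩) r) := by
  rw [E.natural f x r (𝟙 α) (x.trans ⟨f, hf⟩) fun _ => rfl, E.coeff.map_id]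
  rfl

/-- A permutation identifying two terms after composition with `f` already identifies them before,
because `f` can be cancelled. -/
theorem map_injective (E : SemiAnalytic T) {X Y : Type u} (f : X ⟶ Y) (hf : Function.Injective f) :
    Function.Injective (T.map f) := by
  intro s t hst
  obtain ⟨α, x, r, rfl⟩ := E.exists_eq_mk s
  obtain ⟨β, y, q, rfl⟩ := E.exists_eq_mk t
  rw [E.map_mk_of_injective f hf, E.map_mk_of_injective f hf] at hst
  have h := (E.equiv Y).injective hst
  obtain rfl : α = β := congrArg Sigma.fst h
  obtain ⟨σ, h1, h2⟩ := Quotient.exact (eq_of_heq (Sigma.mk.inj h).2)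
  refine congrArg (E.equiv X) (congrArg (Sigma.mk α) (Quotient.sound ⟨σ, ?_, h2⟩))
  ext i
  exact hf (DFunLike.congr_fun h1 i)

theorem mem_range_map_iff {X Y : Type u} (f : X ⟶ Y) (hf : Function.Injective f) (t : T.obj Y) :
    t ∈ Set.range (T.map f) ↔ E.supp t ⊆ Set.range f := by
  constructor
  · rintro ⟨s, rfl⟩
    rw [supp_map]
    exact Set.image_subset_range _ _
  · intro h
    obtain ⟨α, x, r, rfl⟩ := E.exists_eq_mk t
    rw [supp_mk] at h
    choose y hy using fun i => h ⟨i, rfl⟩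
    refine ⟨E.equiv X (Terms.mk ⟨y, fun i j hij => x.injective ?_⟩ r), ?_⟩
    · rw [← hy i, hij, hy j]
    · rw [E.map_mk_of_injective f hf]
      congr 2
      ext i
      exact hy i

/-- The inclusion of a subset. -/
abbrev incl {X : Type u} (S : Set X) : (S : Type u) ⟶ X := ↾(Subtype.val : S → X)

theorem incl_injective {X : Type u} (S : Set X) : Function.Injective (incl S) :=
  Subtype.val_injective

theorem range_incl {X : Type u} (S : Set X) : Set.range (incl S) = S :=
  Subtype.range_val

theorem exists_map_incl {X : Type u} (t : T.obj X) (S : Set X) (h : E.supp t ⊆ S) :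
    ∃ s : T.obj S, T.map (incl S) s = t :=
  (E.mem_range_map_iff (incl S) (incl_injective S) t).2 (by rwa [range_incl])

end SemiAnalytic

/-- The component of `λ` at a substitution instance `T(x)(t)` of a term `t` of full support. -/
theorem lambda_map {A : Type u} [CompleteSemilatticeSup A] (E : SemiAnalytic T)
    (F : PolyFunctor A (Type u)) {I : Type u} (x : I ↪ coprod F) (t : T.obj I)
    (ht : E.supp t = Set.univ) :
    lambda E F (T.map (↾x) t) =
      ⟨sSup (Set.range fun i => (x i).1),
        T.map (transport F x (Set.range fun i => (x i).1) Set.mem_range_self) t⟩ := by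
  obtain ⟨β, y, s, rfl⟩ := E.exists_eq_mk t
  rw [E.supp_mk, Set.range_eq_univ] at ht
  rw [E.map_mk_of_injective _ x.injective, lambda_mk]
  -- The two ranges are equal only propositionally while the type of `transport` depends on them;
  -- abstracting them to `S` and `S'` allows substitution.
  have key : ∀ (S S' : Set A) (hS : ∀ i, (x i).1 ∈ S) (hS' : ∀ i, (x (y i)).1 ∈ S'), S' = S →
      (⟨sSup S', T.map (transport F (fun i => x (y i)) S' hS')
        (E.equiv β.toSet (Terms.mk (Function.Embedding.refl _) s))⟩ :
          Σ a : A, T.obj (F.obj a)) =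
      ⟨sSup S, T.map (transport F x S hS) (E.equiv I (Terms.mk y s))⟩ := by
    rintro S S' hS hS' rfl
    have h1 : transport F (fun i => x (y i)) S' hS' = (↾y) ≫ transport F x S' hS := rfl
    have h2 : E.equiv I (Terms.mk y s) =
        T.map (↾y) (E.equiv β.toSet (Terms.mk (Function.Embedding.refl _) s)) :=
      (E.map_mk_of_injective (↾y) y.injective (Function.Embedding.refl _) s).symm
    rw [h1, h2, T.map_comp]
    rfl
  exact key _ _ Set.mem_range_self Set.mem_range_self (ht.range_comp fun i => (x i).1)

theorem lambda_fst {A : Type u} [CompleteSemilatticeSup A] (E : SemiAnalytic T)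
    (F : PolyFunctor A (Type u)) (t : T.obj (coprod F)) :
    (lambda E F t).1 = sSup (Sigma.fst '' E.supp t) := by
  obtain ⟨α, x, r, rfl⟩ := E.exists_eq_mk t
  rw [lambda_mk, E.supp_mk, ← Set.range_comp]
  rfl

end Support

/-! ### Semi-cartesian transformations and supports -/

section SemiCartesian

variable {G H : Type u ⥤ Type u}

theorem IsSemiCartesian.exists_map_eq {τ : G ⟶ H} (hτ : IsSemiCartesian τ) {X Y : Type u}
    (f : X ⟶ Y) (hf : Function.Injective f) (s : G.obj Y) (t : H.obj X)
    (h : τ.app Y s = H.map f t) : ∃ s' : G.obj X, G.map f s' = s := by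
  obtain ⟨s', h1, -⟩ := Limits.Types.exists_of_isPullback (hτ f hf) s t h
  exact ⟨s', h1⟩

/-- A term is the image of a term over its own support, and naturality carries this presentation
through `τ`. -/
theorem supp_app_subset (D : SemiAnalytic G) (E : SemiAnalytic H) (τ : G ⟶ H) {X : Type u}
    (t : G.obj X) : E.supp (τ.app X t) ⊆ D.supp t := by
  obtain ⟨s, hs⟩ := D.exists_map_incl t _ subset_rfl
  have h := (E.mem_range_map_iff (SemiAnalytic.incl (D.supp t))
    (SemiAnalytic.incl_injective _) (τ.app X t)).1 ⟨τ.app _ s,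
      (NatTrans.naturality_apply τ _ s).symm.trans (congrArg (τ.app X) hs)⟩
  rwa [SemiAnalytic.range_incl] at h

/-- The pullback condition at the inclusion of the support of `τ t` forces `t` to live there.
Conversely, equal supports give the lift along an injection, and its uniqueness holds because `G`
and `H` preserve injections. -/
theorem isSemiCartesian_iff_supp (D : SemiAnalytic G) (E : SemiAnalytic H) (τ : G ⟶ H) :
    IsSemiCartesian τ ↔ ∀ (X : Type u) (t : G.obj X), E.supp (τ.app X t) = D.supp t := by
  constructor
  · intro hτ X t
    refine (supp_app_subset D E τ t).antisymm ?_
    obtain ⟨v, hv⟩ := E.exists_map_incl (τ.app X t) _ subset_rfl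
    have h := (D.mem_range_map_iff _ (SemiAnalytic.incl_injective _) t).1
      (hτ.exists_map_eq _ (SemiAnalytic.incl_injective _) t v hv.symm)
    rwa [SemiAnalytic.range_incl] at h
  · intro h X Y f hf
    rw [Limits.Types.isPullback_iff]
    refine ⟨τ.naturality f, fun s t hst => D.map_injective f hf hst.1, fun t v htv => ?_⟩
    obtain ⟨s, hs⟩ := (D.mem_range_map_iff f hf t).2 (by
      rw [← h, htv, E.supp_map]; exact Set.image_subset_range _ _)
    refine ⟨s, hs, E.map_injective f hf ?_⟩
    rw [← htv, ← hs]
    exact (NatTrans.naturality_apply τ f s).symm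

end SemiCartesian

/-! ### Suplattices as algebras -/

theorem sSup_iUnion_eq {A I : Type u} [CompleteSemilatticeSup A] (S : Set I) (f : I → Set A) :
    sSup (⋃ i ∈ S, f i) = sSup ((fun i => sSup (f i)) '' S) := by
  refine (isLUB_sSup _).unique ⟨?_, fun y hy => sSup_le fun a ha => ?_⟩
  · rintro _ ha
    obtain ⟨i, hi, ha⟩ := Set.mem_iUnion₂.1 ha
    exact (le_sSup ha).trans (le_sSup ⟨i, hi, rfl⟩)
  · obtain ⟨i, hi, rfl⟩ := ha
    exact sSup_le fun b hb => hy (Set.mem_iUnion₂.2 ⟨i, hi, hb⟩)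

namespace SANMonad

variable (T : SANMonad.{u})

/-- The support of an element of `T(X)`. -/
abbrev supp {X : Type u} (t : T.monad.obj X) : Set X := T.semiAnalytic.supp t

theorem supp_unit {X : Type u} (x : X) : T.supp (T.monad.η.app X x) = {x} := by
  have h1 : T.supp (T.monad.η.app X x) ⊆ {x} := by
    have h := (T.semiAnalytic.mem_range_map_iff (SemiAnalytic.incl {x})
      (SemiAnalytic.incl_injective _) (T.monad.η.app X x)).1 ⟨T.monad.η.app _ ⟨x, rfl⟩,
        (NatTrans.naturality_apply T.monad.η (SemiAnalytic.incl {x}) ⟨x, rfl⟩).symm⟩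
    rwa [SemiAnalytic.range_incl] at h
  -- With empty support the unit at `x` would come from `T(∅)`, and the pullback square would
  -- produce an element of `∅`.
  refine (Set.subset_singleton_iff_eq.1 h1).resolve_left fun h0 => ?_
  obtain ⟨v, hv⟩ := T.semiAnalytic.exists_map_incl _ ∅ h0.subset
  obtain ⟨s, -⟩ := T.unit_semiCartesian.exists_map_eq _ (SemiAnalytic.incl_injective _) x v hv.symm
  exact s.2

/-- For `⊆` naturality suffices: `t` comes from `T(T(S))` with `S` the union. For `⊇` the pullback
square of `μ` lifts `t` to a term of terms over the support of `μ t`, so each `w` lives there. -/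
theorem supp_mult {X : Type u} (t : T.monad.obj (T.monad.obj X)) :
    T.supp (T.monad.μ.app X t) = ⋃ w ∈ T.supp t, T.supp w := by
  apply Set.Subset.antisymm
  · set S := ⋃ w ∈ T.supp t, T.supp w
    have hi := SemiAnalytic.incl_injective S
    obtain ⟨s, hs⟩ := (T.semiAnalytic.mem_range_map_iff (T.monad.map (SemiAnalytic.incl S))
      (T.semiAnalytic.map_injective _ hi) t).2 fun w hw =>
        T.semiAnalytic.exists_map_incl w S (Set.subset_biUnion_of_mem (u := fun w => T.supp w) hw)
    have h := (T.semiAnalytic.mem_range_map_iff (SemiAnalytic.incl S) hi (T.monad.μ.app X t)).1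
      ⟨T.monad.μ.app _ s, by
        rw [← hs]; exact (NatTrans.naturality_apply T.monad.μ (SemiAnalytic.incl S) s).symm⟩
    rwa [SemiAnalytic.range_incl] at h
  · refine Set.iUnion₂_subset fun w hw => ?_
    obtain ⟨v, hv⟩ := T.semiAnalytic.exists_map_incl (T.monad.μ.app X t) _ subset_rfl
    have hi := SemiAnalytic.incl_injective (T.supp (T.monad.μ.app X t))
    obtain ⟨s, hs⟩ := T.mult_semiCartesian.exists_map_eq _ hi t v hv.symm
    have hs' := congrArg T.supp hs
    change T.semiAnalytic.supp (T.monad.map (T.monad.map _) s) = _ at hs'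
    rw [T.semiAnalytic.supp_map] at hs'
    rw [← hs'] at hw
    obtain ⟨w', -, rfl⟩ := hw
    have h := (T.semiAnalytic.mem_range_map_iff _ hi _).1 ⟨w', rfl⟩
    rwa [SemiAnalytic.range_incl] at h

theorem plonkaMap_fst {A : Type u} [CompleteSemilatticeSup A] (F : PolyFunctor A T.monad.Algebra)
    (t : T.monad.obj (coprod (underlying F))) :
    (plonkaMap T F t).1 = sSup (Sigma.fst '' T.supp t) :=
  lambda_fst T.semiAnalytic (underlying F) t

theorem plonkaMap_map {A : Type u} [CompleteSemilatticeSup A] (F : PolyFunctor A T.monad.Algebra)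
    {I : Type u} (x : I ↪ coprod (underlying F)) (t : T.monad.obj I) (ht : T.supp t = Set.univ) :
    plonkaMap T F (T.monad.map (↾x) t) =
      ⟨sSup (Set.range fun i => (x i).1), (F.obj _).a (T.monad.map
        (transport (underlying F) x (Set.range fun i => (x i).1) Set.mem_range_self) t)⟩ := by
  unfold plonkaMap
  rw [lambda_map T.semiAnalytic (underlying F) x t ht]

/-- A suplattice as an algebra: every term is evaluated to the supremum of its support. -/
def suplatticeAlgebra (A : Type u) [CompleteSemilatticeSup A] : T.monad.Algebra where
  A := A
  a := ↾(fun t => sSup (T.supp t))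
  unit := by
    ext x
    change sSup (T.supp (T.monad.η.app A x)) = x
    rw [supp_unit]
    exact (isLUB_sSup _).unique isLUB_singleton
  assoc := by
    ext t
    change sSup (T.supp (T.monad.μ.app A t)) =
      sSup (T.semiAnalytic.supp (T.monad.map (↾(fun t => sSup (T.supp t))) t))
    rw [supp_mult, T.semiAnalytic.supp_map, sSup_iUnion_eq]
    rfl

/-- The algebra with one element. -/
def terminalAlgebra : T.monad.Algebra where
  A := PUnit
  a := ↾(fun _ => PUnit.unit)

/-- The functor constant at the algebra with one element. -/
def terminalFunctor (A : Type u) [CompleteSemilatticeSup A] : PolyFunctor A T.monad.Algebra where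
  obj _ := T.terminalAlgebra
  map _ := 𝟙 _
  map_id _ := rfl
  map_comp _ _ := (Category.comp_id _).symm

/-- A suplattice `A` is in bijection with the coproduct of `A` one-element sets. -/
def suplatticeIso (A : Type u) [CompleteSemilatticeSup A] :
    (T.suplatticeAlgebra A).A ≅ coprod (underlying (T.terminalFunctor A)) :=
  Equiv.toIso
    { toFun := fun a => ⟨a, PUnit.unit⟩
      invFun := Sigma.fst
      left_inv := fun _ => rfl
      right_inv := fun _ => rfl }

/-- Only the index in `A` carries information, and both structure maps compute it as the supremum of
the support. -/
theorem isPlonkaSum_suplatticeAlgebra (A : Type u) [CompleteSemilatticeSup A] :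
    IsPlonkaSum T (T.terminalFunctor A) (T.suplatticeAlgebra A) (T.suplatticeIso A) := by
  intro t
  refine Sigma.ext ?_ (heq_of_eq rfl)
  rw [plonkaMap_fst, supp, SemiAnalytic.supp_map, Set.image_image]
  exact congrArg sSup (Set.image_id _).symm

end SANMonad

/-! ### Preservation of Płonka sums -/

section Preservation

variable {R V : SANMonad.{u}} {τ : R.monad ⟶ V.monad}

theorem IsSemiCartesian.plonkaStructuresCoincide (hτ : IsSemiCartesian τ.toNatTrans) :
    PlonkaStructuresCoincide τ := by
  rw [isSemiCartesian_iff_supp R.semiAnalytic V.semiAnalytic] at hτ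
  intro A _ F t
  obtain ⟨α, x, r, rfl⟩ := R.semiAnalytic.exists_eq_mk t
  -- `t₀` is the generic term of which `[x, r]` is a substitution instance. Both `t₀` and `τ t₀`
  -- have full support, so `plonkaMap_map` applies on either side.
  set t₀ := R.semiAnalytic.equiv α.toSet (Terms.mk (Function.Embedding.refl _) r) with ht₀
  have h0 : R.semiAnalytic.supp t₀ = Set.univ := by
    rw [ht₀, SemiAnalytic.supp_mk]; exact Set.range_id
  have ht : R.semiAnalytic.equiv _ (Terms.mk x r) = R.monad.map (↾x) t₀ :=
    (R.semiAnalytic.map_mk_of_injective (↾x) x.injective (Function.Embedding.refl _) r).symm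
  have hn : τ.app _ (R.monad.map (↾x) t₀) = V.monad.map (↾x) (τ.app _ t₀) :=
    NatTrans.naturality_apply τ.toNatTrans (↾x) t₀
  rw [ht, hn, V.plonkaMap_map F x (τ.app _ t₀) ((hτ _ t₀).trans h0)]
  refine (R.plonkaMap_map (F.postcomp (EM τ)) x t₀ h0).trans (Sigma.ext rfl (heq_of_eq ?_))
  exact congrArg (F.obj _).a (NatTrans.naturality_apply τ.toNatTrans _ t₀)

theorem PlonkaStructuresCoincide.preservesPlonkaSums (h : PlonkaStructuresCoincide τ) :
    PreservesPlonkaSums τ := by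
  intro A _ F B e hB t
  have hn : τ.app _ (R.monad.map e.hom t) = V.monad.map e.hom (τ.app _ t) :=
    NatTrans.naturality_apply τ.toNatTrans e.hom t
  exact (hB (τ.app _ t)).trans ((congrArg (plonkaMap V F) hn.symm).trans (h A F _).symm)

theorem PreservesPlonkaSums.isSemiCartesian (h : PreservesPlonkaSums τ) :
    IsSemiCartesian τ.toNatTrans := by
  rw [isSemiCartesian_iff_supp R.semiAnalytic V.semiAnalytic]
  -- This is the index component of the preservation condition for the suplattice algebra of `A`.
  have key (A : Type u) [CompleteSemilatticeSup A] (t : R.monad.obj A) :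
      sSup (V.supp (τ.app A t)) = sSup (R.supp t) := by
    have h1 := congrArg Sigma.fst (h A _ _ _ (V.isPlonkaSum_suplatticeAlgebra A) t)
    refine (h1.trans (R.plonkaMap_fst _ _)).trans (congrArg sSup ?_)
    refine (congrArg (Sigma.fst '' ·) (R.semiAnalytic.supp_map (V.suplatticeIso A).hom t)).trans ?_
    exact (Set.image_image _ _ _).trans (Set.image_id _)
  intro X t
  -- `Set X` is the free suplattice on `X`: a subset is recovered as the supremum of its singletons,
  -- so no part of the support is lost.
  let s : X ⟶ Set X := ↾(fun x => ({x} : Set X))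
  have hn : τ.app _ (R.monad.map s t) = V.monad.map s (τ.app _ t) :=
    NatTrans.naturality_apply τ.toNatTrans s t
  have h1 := key (Set X) (R.monad.map s t)
  rw [hn, SANMonad.supp, SANMonad.supp, SemiAnalytic.supp_map, SemiAnalytic.supp_map] at h1
  have hs (S : Set X) : sSup (s '' S) = S := by
    rw [sSup_image]
    exact Set.biUnion_of_singleton S
  rwa [hs, hs] at h1

end Preservation

end Plonka

theorem mainTheorem3 (R V : Plonka.SANMonad.{u}) (τ : R.monad ⟶ V.monad) :
    List.TFAE [Plonka.IsSemiCartesian τ.toNatTrans, Plonka.PreservesPlonkaSums τ,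
      Plonka.PlonkaStructuresCoincide τ] := by
  tfae_have 1 → 3 := fun h => h.plonkaStructuresCoincide
  tfae_have 3 → 2 := fun h => h.preservesPlonkaSums
  tfae_have 2 → 1 := fun h => h.isSemiCartesian
  tfae_finish
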